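/- **Setting.** Let $\mathcal Z$ be a $\mathbf Z$-group, i.e. a linearly ordered abelian group with a smallest positive element $1$ such that $\mathcal Z/n\mathcal Z$ has exactly $n$ elements for every integer $n\ge 1$; identify $\mathbf Z$ with $\mathbf Z\cdot 1\subseteq\mathcal Z$. Let $\mathcal Q$ be the divisible hull of $\mathcal Z$, $\Omega=\mathcal Q\cup\{+\infty\}$ with the topology generated by the intervals $]a,b[$ and $]a,+\infty]$ ($a,b\in\mathcal Q$), $\Gamma=\mathcal Z\cup\{+\infty\}$, and give $\Omega^m$ the product topology; $\overline A$ denotes the closure of $A$ in $\Omega^m$. The *support* of $a\in\Omega^m$ is $\operatorname{Supp}a=\{i : a_i\ne+\infty\}$. For $J\subseteq\{1,\dots,m\}$ and $A\subseteq\Omega^m$ put $F_J(A)=\{a\in\overline A : \operatorname{Supp}a=J\}$; the non-empty sets $F_J(A)$ are the *faces* of $A$. In particular $F_I(\Gamma^m)$ is the set of points of $\Gamma^m$ with support $I$. The set $A$ is *monohedral* if its faces are linearly ordered by specialisation (for any two faces $B,C$ of $A$, $B\subseteq\overline C$ or $C\subseteq\overline B$). The *frontier* of $A$ is $\partial A=\overline{\overline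 A\setminus A}$. For $m\ge1$, $\widehat a$ (resp. $\widehat A$, $\widehat N$) denotes the image of a point $a$ (resp. a set $A$, a tuple $N$) under the projection onto the first $m-1$ coordinates. A map $f:X\to\Omega$ on a set $X\subseteq F_I(\Gamma^m)$ is *affine* if either $f=+\infty$ on $X$, or there are $\alpha_0\in\mathcal Q$ and $\alpha_i\in\mathbf Q$ ($i\in I$) with $f(a)=\alpha_0+\sum_{i\in I}\alpha_ia_i$ for all $a\in X$. It is *largely continuous* if it extends to a continuous function $\overline X\to\Omega$. Congruences are extended to $\Gamma$ by letting $a\equiv b\;[k]$ hold whenever $a$ or $b$ is $+\infty$. *Precells* mod $N$, for $N$ an $m$-tuple of positive integers, are defined by induction on $m$. If $m=0$, the only precell mod $N$ is $\Gamma^0$, and it is a largely continuous precell. If $m\ge1$, a set $A\subseteq F_I(\Gamma^m)$ (for some $I\subseteq\{1,\dots,m\}$) is a precell mod $N$ if $\widehat A$ is a precell mod $\widehat N$ and there are non-negative affine maps $\mu,\nu:\widehat A\to\Omega$ and an integer $\rho$ with $0\le\rho<N_m$ such that $$A=\{a\in F_I(\Gamma^m) : \widehat a\in\widehat A,\ \mu(\widehat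 a)\le a_m\le\nu(\widehat a),\ a_m\equiv\rho\;[N_m]\};$$ it is a *largely continuous precell* mod $N$ if moreover $\widehat A$ is a largely continuous precell mod $\widehat N$ and $\mu,\nu$ can be chosen largely continuous. **Proposition 5.6.** Let $m\ge 0$, $I\subseteq\{1,\dots,m\}$, $N$ an $m$-tuple of positive integers, and let $A\subseteq F_I(\Gamma^m)$ be a non-closed monohedral largely continuous precell mod $N$. Then for every integer $n\ge1$ there are an $m$-tuple $N'$ of positive integers and a partition $(A_i)_{1\le i\le n}$ of $A$ into (non-empty, pairwise disjoint) largely continuous precells mod $N'$ such that $\partial A_i=\partial A$ for every $1\le i\le n$. -/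

import Mathlib

noncomputable section

namespace Precell

open Set

/-- A `ℤ`-group: a linearly ordered abelian group with a smallest positive element (written `one`;
it is determined by the order) such that `Z / nZ` has exactly `n` elements for every `n ≥ 1`. -/
class ZGroup (Z : Type*) [AddCommGroup Z] [LinearOrder Z] [IsOrderedAddMonoid Z] where
  one : Z
  isLeast_one : IsLeast {x : Z | 0 < x} one
  card_quotient : ∀ n : ℕ, 1 ≤ n → Nat.card (Z ⧸ (nsmulAddMonoidHom (α := Z) n).range) = n

/-- `Ω = 𝒬 ∪ {+∞}`, where `𝒬` is the divisible hull of the ordered group `Z`. -/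
abbrev Omega (Z : Type*) [AddCommGroup Z] [LinearOrder Z] [IsOrderedAddMonoid Z] :=
  WithTop (DivisibleHull Z)

section

variable {Z : Type*} [AddCommGroup Z] [LinearOrder Z] [IsOrderedAddMonoid Z]

/-- `Ω` carries its order topology (see `topology_eq_generateFrom`), and `Ω^m = (Fin m → Ω)` the
product topology. -/
instance : TopologicalSpace (Omega Z) := Preorder.topology _

instance : OrderTopology (Omega Z) := ⟨rfl⟩

/-- The inclusion of `Z` in `Ω`. -/
def ofZ (z : Z) : Omega Z := ((DivisibleHull.coe z : DivisibleHull Z) : WithTop (DivisibleHull Z))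

/-- `Γ = Z ∪ {+∞}`, as a subset of `Ω`. -/
def Gam (Z : Type*) [AddCommGroup Z] [LinearOrder Z] [IsOrderedAddMonoid Z] : Set (Omega Z) :=
  insert ⊤ (range ofZ)

variable {m : ℕ}

/-- The support of a point: the set of indices of its finite coordinates. -/
def supp (a : Fin m → Omega Z) : Finset (Fin m) := Finset.univ.filter fun i => a i ≠ ⊤

/-- `F_I(Γ^m)`: the points of `Γ^m` with support `I`. -/
def stratum (Z : Type*) [AddCommGroup Z] [LinearOrder Z] [IsOrderedAddMonoid Z]
    (I : Finset (Fin m)) : Set (Fin m → Omega Z) :=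
  {a | (∀ i, a i ∈ Gam Z) ∧ supp a = I}

/-- `F_J(A)`: the points of the closure of `A` with support `J`. -/
def face (J : Finset (Fin m)) (A : Set (Fin m → Omega Z)) : Set (Fin m → Omega Z) :=
  {a | a ∈ closure A ∧ supp a = J}

/-- The faces of `A` are the non-empty sets `F_J(A)`. -/
def IsFace (B A : Set (Fin m → Omega Z)) : Prop :=
  ∃ J : Finset (Fin m), B = face J A ∧ B.Nonempty

/-- `A` is monohedral if its faces are linearly ordered by specialisation
(`B ≤ C` iff `B` is contained in the closure of `C`). -/
def Monohedral (A : Set (Fin m → Omega Z)) : Prop :=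
  ∀ B C, IsFace B A → IsFace C A → B ⊆ closure C ∨ C ⊆ closure B

/-- The frontier `∂A` used here: the closure of `closure A \ A` (not Mathlib's `frontier`). -/
def bdry (A : Set (Fin m → Omega Z)) : Set (Fin m → Omega Z) := closure (closure A \ A)

/-- The socle of a point: its first `m` coordinates. The socle of a set `A` is `socle '' A`. -/
def socle (a : Fin (m + 1) → Omega Z) : Fin m → Omega Z := fun i => a i.castSucc

/-- `f` is affine on `X` (a set all of whose points have the same support): either constantly `+∞`,
or `f(a) = α₀ + ∑ αᵢ aᵢ`, the sum being over the support, with `α₀ ∈ 𝒬` and `αᵢ ∈ ℚ`. -/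
def IsAffineOn (f : (Fin m → Omega Z) → Omega Z) (X : Set (Fin m → Omega Z)) : Prop :=
  (∀ a ∈ X, f a = ⊤) ∨
    ∃ (α₀ : DivisibleHull Z) (α : Fin m → ℚ), ∀ a ∈ X,
      f a = ((α₀ + ∑ i ∈ supp a, α i • (a i).untopD 0 : DivisibleHull Z) :
        WithTop (DivisibleHull Z))

/-- `f` is largely continuous on `X`: its restriction to `X` extends to a continuous function on
the closure of `X`. -/
def LargelyContinuousOn (f : (Fin m → Omega Z) → Omega Z) (X : Set (Fin m → Omega Z)) : Prop :=
  ∃ g : (Fin m → Omega Z) → Omega Z, ContinuousOn g (closure X) ∧ EqOn g f X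

/-- The congruence `a ≡ b [k]` on `Γ`, which holds by convention as soon as `a` or `b` is `+∞`. -/
def CongrMod (k : ℕ) (a b : Omega Z) : Prop :=
  a = ⊤ ∨ b = ⊤ ∨ ∃ x y z : Z, a = ofZ x ∧ b = ofZ y ∧ x - y = k • z

variable [ZGroup Z]

/-- The topology of `Ω` is generated by the open intervals `]a, b[` and the intervals `]a, +∞]`,
for `a, b ∈ 𝒬`. -/
theorem topology_eq_generateFrom : (inferInstance : TopologicalSpace (Omega Z)) =
    TopologicalSpace.generateFrom
      ({s | ∃ a b : DivisibleHull Z, s = Ioo (a : WithTop (DivisibleHull Z)) b} ∪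
        {s | ∃ a : DivisibleHull Z, s = Ioi (a : WithTop (DivisibleHull Z))}) := by
  have hpos : (0 : DivisibleHull Z) < DivisibleHull.mk (ZGroup.one : Z) 1 := by
    rw [← DivisibleHull.mk_zero 1, DivisibleHull.mk_lt_mk]
    have h1 : (0 : Z) < ZGroup.one := ZGroup.isLeast_one.1
    simpa using h1
  apply le_antisymm
  · refine le_generateFrom ?_
    rintro s (⟨a, b, rfl⟩ | ⟨a, rfl⟩)
    · exact isOpen_Ioo
    · exact isOpen_Ioi
  · refine le_generateFrom ?_
    have key : ∀ b : DivisibleHull Z, @IsOpen _ (TopologicalSpace.generateFrom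
        ({s | ∃ a b : DivisibleHull Z, s = Ioo (a : WithTop (DivisibleHull Z)) b} ∪
        {s | ∃ a : DivisibleHull Z, s = Ioi (a : WithTop (DivisibleHull Z))}))
        (Iio (b : WithTop (DivisibleHull Z))) := fun b => by
      have : Iio (b : WithTop (DivisibleHull Z)) =
          ⋃ a : DivisibleHull Z, Ioo (a : WithTop (DivisibleHull Z)) b := by
        ext x
        simp only [mem_Iio, mem_iUnion, mem_Ioo]
        refine ⟨fun h => ?_, fun ⟨_, h⟩ => h.2⟩
        obtain ⟨y, rfl⟩ := WithTop.ne_top_iff_exists.1 (h.trans_le le_top).ne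
        exact ⟨y - DivisibleHull.mk (ZGroup.one : Z) 1,
          WithTop.coe_lt_coe.2 (sub_lt_self y hpos), h⟩
      rw [this]
      exact @isOpen_iUnion _ _ (TopologicalSpace.generateFrom _) _ fun a =>
        TopologicalSpace.isOpen_generateFrom_of_mem (Or.inl ⟨a, b, rfl⟩)
    rintro s ⟨a, rfl | rfl⟩
    · induction a using WithTop.recTopCoe with
      | top => simp
      | coe a => exact TopologicalSpace.isOpen_generateFrom_of_mem (Or.inr ⟨a, rfl⟩)
    · induction a using WithTop.recTopCoe with
      | top =>
        have : Iio (⊤ : WithTop (DivisibleHull Z)) =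
            ⋃ b : DivisibleHull Z, Iio (b : WithTop (DivisibleHull Z)) := by
          ext x
          simp only [mem_Iio, mem_iUnion]
          refine ⟨fun h => ?_, fun ⟨_, h⟩ => h.trans_le le_top⟩
          obtain ⟨y, rfl⟩ := WithTop.ne_top_iff_exists.1 h.ne
          exact ⟨y + DivisibleHull.mk (ZGroup.one : Z) 1,
            WithTop.coe_lt_coe.2 (lt_add_of_pos_right y hpos)⟩
        rw [this]
        exact @isOpen_iUnion _ _ (TopologicalSpace.generateFrom _) _ key
      | coe a => exact key a

/-- `(μ, ν, ρ)` is a presentation of `A ⊆ F_I(Γ^{m+1})`, with congruence modulo `k` on the last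
coordinate. Only the values of `μ` and `ν` on the socle of `A` matter. The integer `ρ` is seen
in `Z` as `ρ • one`. -/
def IsPresentation (I : Finset (Fin (m + 1))) (k : ℕ+) (A : Set (Fin (m + 1) → Omega Z))
    (μ ν : (Fin m → Omega Z) → Omega Z) (ρ : ℤ) : Prop :=
  IsAffineOn μ (socle '' A) ∧ IsAffineOn ν (socle '' A) ∧
  (∀ x ∈ socle '' A, 0 ≤ μ x) ∧ (∀ x ∈ socle '' A, 0 ≤ ν x) ∧
  0 ≤ ρ ∧ ρ < (k : ℤ) ∧
  A = {a | a ∈ stratum Z I ∧ socle a ∈ socle '' A ∧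
        μ (socle a) ≤ a (Fin.last m) ∧ a (Fin.last m) ≤ ν (socle a) ∧
        CongrMod (k : ℕ) (a (Fin.last m)) (ofZ (ρ • (ZGroup.one : Z)))}

/-- Precells mod `N` in `Γ^m`. -/
def IsPrecell : {m : ℕ} → (Fin m → ℕ+) → Set (Fin m → Omega Z) → Prop
  | 0, _, A => A = univ
  | m + 1, N, A => IsPrecell (fun i : Fin m => N i.castSucc) (socle '' A) ∧
      ∃ I : Finset (Fin (m + 1)), A ⊆ stratum Z I ∧
        ∃ μ ν ρ, IsPresentation I (N (Fin.last m)) A μ ν ρ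

/-- Largely continuous precells mod `N` in `Γ^m`. -/
def IsLCPrecell : {m : ℕ} → (Fin m → ℕ+) → Set (Fin m → Omega Z) → Prop
  | 0, _, A => A = univ
  | m + 1, N, A => IsPrecell N A ∧ IsLCPrecell (fun i : Fin m => N i.castSucc) (socle '' A) ∧
      ∃ I : Finset (Fin (m + 1)), A ⊆ stratum Z I ∧
        ∃ μ ν ρ, IsPresentation I (N (Fin.last m)) A μ ν ρ ∧
          LargelyContinuousOn μ (socle '' A) ∧ LargelyContinuousOn ν (socle '' A)

end

end Precell

end

open Precell

/-!
The proof is by induction on the number of coordinates. Write `X` for the socle of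
`A ⊆ F_I(Γ^{m+1})` and `μ ≤ a_{m+1} ≤ ν`, `a_{m+1} ≡ ρ [k]` for a presentation of `A` over `X`, with `μ` and `ν`
replaced by their continuous extensions to the closure of `X`.

Everything rests on discreteness. On a set of points with coordinates in `Z`, an affine map with
rational coefficients takes its finite values in one coset of a lattice `D⁻¹ Z`, so near any point
where its limit is finite it is constant (`LatticeValuedOn.eventually_eq`). Two consequences follow.
A set `A ⊆ F_I(Γ^m)` is relatively closed among the points of support `I`, hence `∂A` is just
`closure A \ A` (`bdry_eq`). And the closure of `A` consists exactly of the points over `closure X`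
which satisfy the same inequalities and the same congruence (`IsPresentation.mem_closure_iff`); here
one uses that every residue class modulo `k` is cofinal in `Z`.

If the last coordinate is finite on `A` and `ν = +∞`, then `A` has the face `X × {+∞}`. As `A` is
monohedral, no other proper face of `A` can have a finite last coordinate, since its support would be
incomparable with that of this one (`IsPresentation.last_eq_top_of_mem_closure_diff`). Hence
`∂A = closure X × {+∞}`, and splitting the class of `ρ` modulo `k` into `n` classes modulo `n k`
does not change it (`IsPresentation.bdry_residuePart`).

Otherwise `A` is relatively closed over `X` (`IsPresentation.mem_of_socle_mem`), so `X` is not closed.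
It is monohedral (`IsPresentation.monohedral_socle`), because every point of `closure X` lifts to
`closure A`. The induction hypothesis partitions `X`, and pulling this partition back to `A` does not
change the frontier, as all points of `∂A` lie over `∂X` (`IsPresentation.bdry_restrict`).
-/

namespace Precell

open Set Filter Topology

section

/-! ### The values of `Ω` -/

variable {Z : Type*} [AddCommGroup Z] [LinearOrder Z] [IsOrderedAddMonoid Z]

theorem ofZ_ne_top (z : Z) : ofZ z ≠ ⊤ := WithTop.coe_ne_top

theorem ofZ_injective : Function.Injective (ofZ : Z → Omega Z) := fun _ _ h =>
  DivisibleHull.coe_injective (WithTop.coe_injective h)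

theorem ofZ_le_ofZ {x y : Z} : ofZ x ≤ ofZ y ↔ x ≤ y := by
  simp [ofZ]

/-- Every finite element of `Ω` is bounded above by an element of `Z`. -/
theorem exists_le_ofZ (q : DivisibleHull Z) : ∃ z : Z, (q : Omega Z) ≤ ofZ z := by
  induction q with
  | mk x s =>
    refine ⟨|x|, WithTop.coe_le_coe.2 ?_⟩
    rw [DivisibleHull.mk_le_mk]
    calc ((1 : ℕ+) : ℕ) • x = x := by simp
      _ ≤ |x| := le_abs_self x
      _ = 1 • |x| := (one_nsmul _).symm
      _ ≤ (s : ℕ) • |x| := nsmul_le_nsmul_left (abs_nonneg x) s.pos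

theorem congrMod_ofZ_iff {k : ℕ} {x y : Z} :
    CongrMod k (ofZ x) (ofZ y) ↔ ∃ z : Z, x - y = k • z := by
  constructor
  · rintro (h | h | ⟨x', y', z, hx, hy, h⟩)
    · exact absurd h (ofZ_ne_top _)
    · exact absurd h (ofZ_ne_top _)
    · rw [ofZ_injective hx, ofZ_injective hy]
      exact ⟨z, h⟩
  · rintro ⟨z, h⟩
    exact Or.inr (Or.inr ⟨x, y, z, rfl, rfl, h⟩)

/-! ### Lattice-valued functions -/

/-- The finite values of `f` on `S` lie in a single coset of a lattice `D⁻¹ Z` of `𝒬`. -/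
def LatticeValuedOn {α : Type*} (f : α → Omega Z) (S : Set α) : Prop :=
  ∃ D : ℕ, 0 < D ∧ ∀ a ∈ S, ∀ b ∈ S, ∀ p r : DivisibleHull Z, f a = p → f b = r →
    ∃ z : Z, (D : ℚ) • (p - r) = (z : DivisibleHull Z)

theorem latticeValuedOn_of_mem_gam {α : Type*} {f : α → Omega Z} {S : Set α}
    (h : ∀ a ∈ S, f a ∈ Gam Z) : LatticeValuedOn f S := by
  refine ⟨1, one_pos, fun a ha b hb p r hp hr => ?_⟩
  have key : ∀ a ∈ S, ∀ p : DivisibleHull Z, f a = p → ∃ z : Z, p = (z : DivisibleHull Z) := by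
    intro a ha p hp
    rcases h a ha with h | ⟨z, h⟩
    · exact absurd (hp.symm.trans h) WithTop.coe_ne_top
    · exact ⟨z, WithTop.coe_injective (hp.symm.trans h.symm)⟩
  obtain ⟨x, rfl⟩ := key a ha p hp
  obtain ⟨y, rfl⟩ := key b hb r hr
  exact ⟨x - y, by
    simpa using ((DivisibleHull.coeAddMonoidHom Z).map_sub x y).symm⟩

theorem divisibleHull_coe_sum_zsmul {M ι : Type*} [AddCommGroup M] (s : Finset ι) (c : ι → ℤ)
    (x : ι → M) :
    ((∑ i ∈ s, c i • x i : M) : DivisibleHull M) = ∑ i ∈ s, (c i : ℚ) • (x i : DivisibleHull M) := by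
  refine (map_sum (DivisibleHull.coeAddMonoidHom M) (fun i => c i • x i) s).trans
    (Finset.sum_congr rfl fun i _ => ?_)
  rw [Int.cast_smul_eq_zsmul, DivisibleHull.zsmul_mk]
  rfl

/-! ### Supports and affine maps -/

variable {m : ℕ}

theorem supp_eq {I : Finset (Fin m)} {a : Fin m → Omega Z} :
    supp a = I ↔ ∀ i, i ∈ I ↔ a i ≠ ⊤ := by
  simp only [supp, Finset.ext_iff, Finset.mem_filter, Finset.mem_univ, true_and]
  exact forall_congr' fun i => Iff.comm

theorem mem_supp {a : Fin m → Omega Z} {i : Fin m} : i ∈ supp a ↔ a i ≠ ⊤ := by simp [supp]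

/-- On points with `Z`-coordinates an affine map takes its values in `α₀ + D⁻¹ Z`, where `D` is a
common denominator of its coefficients. -/
theorem IsAffineOn.latticeValuedOn {f : (Fin m → Omega Z) → Omega Z} {I : Finset (Fin m)}
    {S : Set (Fin m → Omega Z)} (hS : S ⊆ stratum Z I) (hf : IsAffineOn f S) :
    LatticeValuedOn f S := by
  rcases hf with hf | ⟨α₀, α, hf⟩
  · exact ⟨1, one_pos, fun a ha b hb p r hp _ => absurd (hp.symm.trans (hf a ha)) WithTop.coe_ne_top⟩
  set D : ℕ := ∏ i, (α i).den with hD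
  have hc : ∀ i, ∃ c : ℤ, (D : ℚ) * α i = c := by
    intro i
    obtain ⟨e, he⟩ : (α i).den ∣ D := Finset.dvd_prod_of_mem _ (Finset.mem_univ i)
    refine ⟨e * (α i).num, ?_⟩
    rw [he]
    push_cast
    rw [← Rat.den_mul_eq_num (α i)]
    ring
  choose c hc using hc
  have hz : ∀ a ∈ S, ∃ x : Fin m → Z, ∀ i ∈ I, a i = ofZ (x i) := by
    intro a ha
    have : ∀ i, ∃ x : Z, i ∈ I → a i = ofZ x := by
      intro i
      by_cases hi : i ∈ I
      · rcases (hS ha).1 i with h | ⟨z, h⟩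
        · exact absurd h ((supp_eq.1 (hS ha).2 i).1 hi)
        · exact ⟨z, fun _ => h.symm⟩
      · exact ⟨0, fun h => absurd h hi⟩
    choose x hx using this
    exact ⟨x, hx⟩
  have key : ∀ a ∈ S, ∃ x : Z, ∀ p : DivisibleHull Z, f a = p →
      (D : ℚ) • p = (D : ℚ) • α₀ + (x : DivisibleHull Z) := by
    intro a ha
    obtain ⟨x, hx⟩ := hz a ha
    refine ⟨∑ i ∈ I, c i • x i, fun p hp => ?_⟩
    rw [hf a ha] at hp
    rw [← WithTop.coe_injective hp, (hS ha).2, smul_add, divisibleHull_coe_sum_zsmul,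
      Finset.smul_sum]
    congr 1
    refine Finset.sum_congr rfl fun i hi => ?_
    rw [hx i hi, smul_smul, hc]
    rfl
  refine ⟨D, Finset.prod_pos fun i _ => (α i).den_pos, fun a ha b hb p r hp hr => ?_⟩
  obtain ⟨x, hx⟩ := key a ha
  obtain ⟨y, hy⟩ := key b hb
  refine ⟨x - y, ?_⟩
  rw [smul_sub, hx p hp, hy r hr, add_sub_add_left_eq_sub]
  simpa using ((DivisibleHull.coeAddMonoidHom Z).map_sub x y).symm

theorem eq_top_of_mem_closure_of_forall {S : Set (Fin m → Omega Z)} {i : Fin m}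
    (hS : ∀ a ∈ S, a i = ⊤) {b : Fin m → Omega Z} (hb : b ∈ closure S) : b i = ⊤ := by
  have hcl : IsClosed {x : Fin m → Omega Z | x i = ⊤} :=
    isClosed_singleton.preimage (continuous_apply i)
  exact hcl.closure_subset_iff.2 hS hb

/-- A point of the closure of `S ⊆ F_I(Γ^m)` has support in `I`. -/
theorem eq_top_of_mem_closure {I : Finset (Fin m)} {S : Set (Fin m → Omega Z)}
    (hS : S ⊆ stratum Z I) {b : Fin m → Omega Z} (hb : b ∈ closure S) {i : Fin m} (hi : i ∉ I) :
    b i = ⊤ :=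
  eq_top_of_mem_closure_of_forall (fun a ha => by
    by_contra h
    exact hi ((supp_eq.1 (hS ha).2 i).2 h)) hb

variable [ZGroup Z]

/-! ### Closures of subsets of a stratum -/

theorem zgroup_one_pos : (0 : Z) < ZGroup.one := ZGroup.isLeast_one.1

theorem one_le_of_pos {z : Z} (h : 0 < z) : ZGroup.one ≤ z := ZGroup.isLeast_one.2 h

/-- A lattice-valued function with a finite limit is eventually equal to that limit: two points of
a coset of `D⁻¹ Z` at distance less than `D⁻¹` coincide. -/
theorem LatticeValuedOn.eventually_eq {α : Type*} {f : α → Omega Z} {S : Set α}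
    (hf : LatticeValuedOn f S) {F : Filter α} [F.NeBot] (hS : S ∈ F) {q : DivisibleHull Z}
    (hq : Tendsto f F (𝓝 (q : Omega Z))) : ∀ᶠ a in F, f a = q := by
  obtain ⟨D, hD, hf⟩ := hf
  set ε : DivisibleHull Z := (2 * D : ℚ)⁻¹ • ((ZGroup.one : Z) : DivisibleHull Z) with hε
  have hD' : (0 : ℚ) < D := by exact_mod_cast hD
  have h1 : (0 : DivisibleHull Z) < ((ZGroup.one : Z) : DivisibleHull Z) := by
    rw [← DivisibleHull.mk_zero 1, DivisibleHull.mk_lt_mk]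
    simpa using zgroup_one_pos (Z := Z)
  have hε0 : 0 < ε := smul_pos (by positivity) h1
  have hε2 : (D : ℚ) • (ε + ε) = ((ZGroup.one : Z) : DivisibleHull Z) := by
    rw [← two_smul ℚ, smul_smul, hε, smul_smul, mul_comm (D : ℚ), mul_inv_cancel₀ (by positivity),
      one_smul]
  have hU : ∀ᶠ a in F, f a ∈ Ioo ((q - ε : DivisibleHull Z) : Omega Z) (q + ε : DivisibleHull Z) :=
    hq (Ioo_mem_nhds (WithTop.coe_lt_coe.2 (sub_lt_self q hε0))
      (WithTop.coe_lt_coe.2 (lt_add_of_pos_right q hε0)))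
  have hU' := hU.and hS
  have aux : ∀ a b, f a ∈ Ioo ((q - ε : DivisibleHull Z) : Omega Z) (q + ε : DivisibleHull Z) →
      f b ∈ Ioo ((q - ε : DivisibleHull Z) : Omega Z) (q + ε : DivisibleHull Z) → a ∈ S → b ∈ S →
      f a ≤ f b := by
    intro a b ha hb haS hbS
    obtain ⟨p, hp⟩ := WithTop.ne_top_iff_exists.1 (ha.2.trans_le le_top).ne
    obtain ⟨r, hr⟩ := WithTop.ne_top_iff_exists.1 (hb.2.trans_le le_top).ne
    obtain ⟨z, hz⟩ := hf a haS b hbS p r hp.symm hr.symm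
    rw [← hp, ← hr, WithTop.coe_le_coe]
    rw [← hp] at ha
    rw [← hr] at hb
    have h2 : p - r < ε + ε := by
      have h3 := WithTop.coe_lt_coe.1 ha.2
      have h4 := WithTop.coe_lt_coe.1 hb.1
      calc p - r < (q + ε) - (q - ε) := sub_lt_sub h3 h4
        _ = ε + ε := by abel
    have h5 : (D : ℚ) • (p - r) < (D : ℚ) • (ε + ε) := smul_lt_smul_of_pos_left h2 hD'
    rw [hz, hε2, DivisibleHull.mk_lt_mk] at h5
    have h6 : z < ZGroup.one := by simpa using h5
    by_contra! h7
    have h8 : 0 < (D : ℚ) • (p - r) := smul_pos hD' (sub_pos.2 h7)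
    rw [hz, ← DivisibleHull.mk_zero 1, DivisibleHull.mk_lt_mk] at h8
    exact absurd (one_le_of_pos (by simpa using h8)) (not_le.2 h6)
  obtain ⟨a₀, ha₀, ha₀S⟩ := hU'.exists
  have hconst : ∀ᶠ a in F, f a = f a₀ := by
    filter_upwards [hU'] with a ha
    exact le_antisymm (aux a a₀ ha.1 ha₀ ha.2 ha₀S) (aux a₀ a ha₀ ha.1 ha₀S ha.2)
  have hlim : f a₀ = q :=
    tendsto_nhds_unique (tendsto_const_nhds.congr' (hconst.mono fun _ h => h.symm)) hq
  exact hconst.mono fun a ha => ha.trans hlim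

theorem eventually_coord_eq {I : Finset (Fin m)} {S : Set (Fin m → Omega Z)}
    (hS : S ⊆ stratum Z I) {b : Fin m → Omega Z} (hb : b ∈ closure S) {i : Fin m}
    (hi : b i ≠ ⊤) : ∀ᶠ a in 𝓝[S] b, a i = b i := by
  obtain ⟨q, hq⟩ := WithTop.ne_top_iff_exists.1 hi
  have := mem_closure_iff_nhdsWithin_neBot.1 hb
  have hl : LatticeValuedOn (fun a : Fin m → Omega Z => a i) S :=
    latticeValuedOn_of_mem_gam fun a ha => (hS ha).1 i
  rw [← hq]
  refine hl.eventually_eq self_mem_nhdsWithin ?_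
  rw [hq]
  exact ((continuous_apply i).tendsto b).mono_left nhdsWithin_le_nhds

theorem mem_of_mem_closure_of_supp_eq {I : Finset (Fin m)} {S : Set (Fin m → Omega Z)}
    (hS : S ⊆ stratum Z I) {b : Fin m → Omega Z} (hb : b ∈ closure S) (hI : supp b = I) :
    b ∈ S := by
  have := mem_closure_iff_nhdsWithin_neBot.1 hb
  have h : ∀ᶠ a in 𝓝[S] b, ∀ i, a i = b i := by
    rw [eventually_all]
    intro i
    by_cases hi : i ∈ I
    · exact eventually_coord_eq hS hb ((supp_eq.1 hI i).1 hi)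
    · filter_upwards [self_mem_nhdsWithin] with a ha
      rw [eq_top_of_mem_closure hS hb hi, eq_top_of_mem_closure hS (subset_closure ha) hi]
  obtain ⟨a, ha, haS⟩ := (h.and self_mem_nhdsWithin).exists
  rwa [← funext ha]

/-- For `S ⊆ F_I(Γ^m)`, the set `closure S \ S` is already closed: it is cut out of `closure S` by
the closed condition that some coordinate in `I` is infinite. -/
theorem bdry_eq {I : Finset (Fin m)} {S : Set (Fin m → Omega Z)} (hS : S ⊆ stratum Z I) :
    bdry S = closure S \ S := by
  refine IsClosed.closure_eq ?_
  have : closure S \ S = closure S ∩ ⋃ i ∈ I, {x : Fin m → Omega Z | x i = ⊤} := by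
    ext x
    simp only [Set.mem_sdiff, mem_inter_iff, mem_iUnion, mem_ofPred_eq, exists_prop]
    refine and_congr_right fun hx => ⟨fun h => ?_, ?_⟩
    · by_contra! h'
      refine h (mem_of_mem_closure_of_supp_eq hS hx (supp_eq.2 fun i => ⟨h' i, fun hi => ?_⟩))
      by_contra hiI
      exact hi (eq_top_of_mem_closure hS hx hiI)
    · rintro ⟨i, hi, hx⟩ hxS
      exact (supp_eq.1 (hS hxS).2 i).1 hi hx
  rw [this]
  exact isClosed_closure.inter (isClosed_biUnion_finset fun i _ =>
    isClosed_singleton.preimage (continuous_apply i))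

/-! ### Residues in a `ℤ`-group -/

/-- The multiples `0, 1, …, k - 1` of the smallest positive element represent `Z / kZ`. -/
theorem existsUnique_residue (k : ℕ) (hk : 1 ≤ k) (z : Z) :
    ∃! j : Fin k, ∃ w : Z, z - (j : ℕ) • ZGroup.one = k • w := by
  set R := (nsmulAddMonoidHom (α := Z) k).range with hR
  have hmem : ∀ x y : Z, (x : Z ⧸ R) = y ↔ ∃ w : Z, y - x = k • w := by
    intro x y
    rw [QuotientAddGroup.eq, neg_add_eq_sub]
    exact ⟨fun ⟨w, hw⟩ => ⟨w, hw.symm⟩, fun ⟨w, hw⟩ => ⟨w, hw.symm⟩⟩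
  let φ : Fin k → Z ⧸ R := fun j => (((j : ℕ) • ZGroup.one : Z) : Z ⧸ R)
  have hcard : Nat.card (Z ⧸ R) = k := ZGroup.card_quotient k hk
  have : Finite (Z ⧸ R) := Nat.finite_of_card_ne_zero (by omega)
  have hlt : ∀ i j : Fin k, i < j → φ i ≠ φ j := by
    intro i j hij h
    obtain ⟨w, hw⟩ := (hmem _ _).1 h
    rw [sub_eq_add_neg, ← sub_nsmul _ (Fin.lt_def.1 hij).le] at hw
    have hlt' := Fin.lt_def.1 hij
    have hpos : 0 < k • w := hw ▸ nsmul_pos zgroup_one_pos (by omega)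
    have hw0 : 0 < w := by
      by_contra! h0
      exact absurd (nsmul_nonpos h0 k) (not_le.2 hpos)
    have h1 : k • (ZGroup.one : Z) ≤ k • w := nsmul_le_nsmul_right (one_le_of_pos hw0) k
    rw [← hw] at h1
    have h2 := (nsmul_le_nsmul_iff_left (zgroup_one_pos (Z := Z))).1 h1
    omega
  have hinj : Function.Injective φ := by
    intro i j h
    rcases lt_trichotomy i j with hij | hij | hij
    · exact absurd h (hlt i j hij)
    · exact hij
    · exact absurd h.symm (hlt j i hij)
  have hbij : Function.Bijective φ := by
    rw [Nat.bijective_iff_injective_and_card]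
    exact ⟨hinj, by rw [hcard]; simp⟩
  obtain ⟨j, hj, huniq⟩ := hbij.existsUnique (z : Z ⧸ R)
  exact ⟨j, (hmem _ _).1 hj, fun i hi => huniq i ((hmem _ _).2 hi)⟩

/-- Every residue class modulo `k ≥ 1` is cofinal in `Z`. -/
theorem exists_ge_congr (k : ℕ) (hk : 1 ≤ k) (r z : Z) : ∃ w, z ≤ w ∧ ∃ y, w - r = k • y := by
  obtain ⟨j, ⟨y, hy⟩, -⟩ := existsUnique_residue k hk (r - z)
  refine ⟨z + (j : ℕ) • ZGroup.one, le_add_of_nonneg_right (nsmul_nonneg zgroup_one_pos.le _),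
    -y, ?_⟩
  rw [smul_neg, ← hy]
  abel

end

section

/-! ### Socles -/

variable {Z : Type*} [AddCommGroup Z] [LinearOrder Z] [IsOrderedAddMonoid Z] {m : ℕ}

/-- The trace on the first `m` coordinates of a set of indices: the support of `socle a` when `I`
is the support of `a`. -/
def baseSupp (I : Finset (Fin (m + 1))) : Finset (Fin m) :=
  Finset.univ.filter fun i => i.castSucc ∈ I

theorem mem_baseSupp {I : Finset (Fin (m + 1))} {i : Fin m} :
    i ∈ baseSupp I ↔ i.castSucc ∈ I := by simp [baseSupp]

theorem supp_socle (a : Fin (m + 1) → Omega Z) : supp (socle a) = baseSupp (supp a) := by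
  ext i
  simp [mem_baseSupp, mem_supp, socle]

theorem socle_image_subset_stratum {I : Finset (Fin (m + 1))} {A : Set (Fin (m + 1) → Omega Z)}
    (hA : A ⊆ stratum Z I) : socle '' A ⊆ stratum Z (baseSupp I) := by
  rintro _ ⟨a, ha, rfl⟩
  exact ⟨fun i => (hA ha).1 _, by rw [supp_socle, (hA ha).2]⟩

/-- The point with socle `x` and last coordinate `c`. -/
def addLast (x : Fin m → Omega Z) (c : Omega Z) : Fin (m + 1) → Omega Z :=
  Fin.snoc (α := fun _ => Omega Z) x c

@[simp]
theorem socle_addLast (x : Fin m → Omega Z) (c : Omega Z) : socle (addLast x c) = x := by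
  ext i
  simp [socle, addLast]

@[simp]
theorem addLast_last (x : Fin m → Omega Z) (c : Omega Z) : addLast x c (Fin.last m) = c := by
  simp [addLast]

@[simp]
theorem addLast_socle (b : Fin (m + 1) → Omega Z) : addLast (socle b) (b (Fin.last m)) = b :=
  Fin.snoc_init_self b

theorem continuous_socle : Continuous (socle : (Fin (m + 1) → Omega Z) → Fin m → Omega Z) :=
  continuous_pi fun i => continuous_apply i.castSucc

theorem continuous_addLast :
    Continuous fun p : (Fin m → Omega Z) × Omega Z => addLast p.1 p.2 := by
  exact Continuous.finSnoc (A := fun _ => Omega Z) continuous_fst continuous_snd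

theorem addLast_mem_stratum_iff {I : Finset (Fin (m + 1))} {x : Fin m → Omega Z} {c : Omega Z} :
    addLast x c ∈ stratum Z I ↔
      x ∈ stratum Z (baseSupp I) ∧ c ∈ Gam Z ∧ (Fin.last m ∈ I ↔ c ≠ ⊤) := by
  simp only [stratum, mem_ofPred_eq, supp_eq, Fin.forall_fin_succ', mem_baseSupp]
  simp only [addLast, Fin.snoc_castSucc, Fin.snoc_last]
  tauto

theorem socle_mem_closure {A : Set (Fin (m + 1) → Omega Z)} {b : Fin (m + 1) → Omega Z}
    (hb : b ∈ closure A) : socle b ∈ closure (socle '' A) :=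
  image_closure_subset_closure_image continuous_socle (mem_image_of_mem _ hb)

theorem socle_image_restrict {A : Set (Fin (m + 1) → Omega Z)}
    {X : Set (Fin m → Omega Z)} (hX : X ⊆ socle '' A) :
    socle '' {a | a ∈ A ∧ socle a ∈ X} = X := by
  ext x
  constructor
  · rintro ⟨a, ha, rfl⟩
    exact ha.2
  · intro hx
    obtain ⟨a, ha, rfl⟩ := hX hx
    exact ⟨a, ⟨ha, hx⟩, rfl⟩

variable [ZGroup Z]

/-! ### Presentations and their closures -/

namespace IsPresentation

variable {I : Finset (Fin (m + 1))} {k : ℕ+} {A : Set (Fin (m + 1) → Omega Z)}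
  {μ ν : (Fin m → Omega Z) → Omega Z} {ρ : ℤ}

theorem mem_iff (h : IsPresentation I k A μ ν ρ) {a : Fin (m + 1) → Omega Z} :
    a ∈ A ↔ a ∈ stratum Z I ∧ socle a ∈ socle '' A ∧ μ (socle a) ≤ a (Fin.last m) ∧
      a (Fin.last m) ≤ ν (socle a) ∧
      CongrMod (k : ℕ) (a (Fin.last m)) (ofZ (ρ • (ZGroup.one : Z))) :=
  Set.ext_iff.1 h.2.2.2.2.2.2 a

theorem subset_stratum (h : IsPresentation I k A μ ν ρ) : A ⊆ stratum Z I :=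
  fun _ ha => (h.mem_iff.1 ha).1

theorem congr (h : IsPresentation I k A μ ν ρ) {μ' ν' : (Fin m → Omega Z) → Omega Z}
    (hμ : EqOn μ' μ (socle '' A)) (hν : EqOn ν' ν (socle '' A)) :
    IsPresentation I k A μ' ν' ρ := by
  have aff : ∀ {f g : (Fin m → Omega Z) → Omega Z}, EqOn g f (socle '' A) →
      IsAffineOn f (socle '' A) → IsAffineOn g (socle '' A) := by
    rintro f g hfg (hf | ⟨α₀, α, hf⟩)
    · exact Or.inl fun a ha => (hfg ha).trans (hf a ha)
    · exact Or.inr ⟨α₀, α, fun a ha => (hfg ha).trans (hf a ha)⟩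
  refine ⟨aff hμ h.1, aff hν h.2.1, fun x hx => (hμ hx).symm ▸ h.2.2.1 x hx,
    fun x hx => (hν hx).symm ▸ h.2.2.2.1 x hx, h.2.2.2.2.1, h.2.2.2.2.2.1, ?_⟩
  ext a
  rw [h.mem_iff]
  refine and_congr_right fun _ => and_congr_right fun ha => ?_
  rw [hμ ha, hν ha]

theorem restrict (h : IsPresentation I k A μ ν ρ) {X : Set (Fin m → Omega Z)}
    (hX : X ⊆ socle '' A) : IsPresentation I k {a | a ∈ A ∧ socle a ∈ X} μ ν ρ := by
  have aff : ∀ {f : (Fin m → Omega Z) → Omega Z}, IsAffineOn f (socle '' A) → IsAffineOn f X := by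
    rintro f (hf | ⟨α₀, α, hf⟩)
    · exact Or.inl fun a ha => hf a (hX ha)
    · exact Or.inr ⟨α₀, α, fun a ha => hf a (hX ha)⟩
  unfold IsPresentation
  rw [socle_image_restrict hX]
  refine ⟨aff h.1, aff h.2.1, fun x hx => h.2.2.1 x (hX hx), fun x hx => h.2.2.2.1 x (hX hx),
    h.2.2.2.2.1, h.2.2.2.2.2.1, ?_⟩
  ext a
  rw [mem_ofPred_eq, h.mem_iff, mem_ofPred_eq]
  constructor
  · rintro ⟨⟨h1, -, h2⟩, h3⟩
    exact ⟨h1, h3, h2⟩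
  · rintro ⟨h1, h3, h2⟩
    exact ⟨⟨h1, hX h3, h2⟩, h3⟩

/-- The closure of a set with a largely continuous presentation: the inequalities and the congruence
persist in the limit and, conversely, cut out exactly the closure. -/
theorem mem_closure_iff (h : IsPresentation I k A μ ν ρ)
    (hμ : ContinuousOn μ (closure (socle '' A))) (hν : ContinuousOn ν (closure (socle '' A)))
    {b : Fin (m + 1) → Omega Z} :
    b ∈ closure A ↔ socle b ∈ closure (socle '' A) ∧ μ (socle b) ≤ b (Fin.last m) ∧
      b (Fin.last m) ≤ ν (socle b) ∧ b (Fin.last m) ∈ Gam Z ∧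
      CongrMod (k : ℕ) (b (Fin.last m)) (ofZ (ρ • (ZGroup.one : Z))) ∧
      (Fin.last m ∉ I → b (Fin.last m) = ⊤) := by
  have hstrat := socle_image_subset_stratum h.subset_stratum
  constructor
  · intro hb
    have hs : socle b ∈ closure (socle '' A) := socle_mem_closure hb
    have := mem_closure_iff_nhdsWithin_neBot.1 hb
    have hsoc : Tendsto (socle : (Fin (m + 1) → Omega Z) → _) (𝓝[A] b)
        (𝓝[closure (socle '' A)] (socle b)) :=
      tendsto_nhdsWithin_iff.2 ⟨continuous_socle.continuousAt.tendsto.mono_left nhdsWithin_le_nhds,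
        eventually_nhdsWithin_of_forall fun a ha => subset_closure (mem_image_of_mem _ ha)⟩
    have hlast : Tendsto (fun a : Fin (m + 1) → Omega Z => a (Fin.last m)) (𝓝[A] b)
        (𝓝 (b (Fin.last m))) :=
      ((continuous_apply _).tendsto b).mono_left nhdsWithin_le_nhds
    refine ⟨hs, le_of_tendsto_of_tendsto ((hμ _ hs).tendsto.comp hsoc) hlast ?_,
      le_of_tendsto_of_tendsto hlast ((hν _ hs).tendsto.comp hsoc) ?_, ?_⟩
    · exact eventually_nhdsWithin_of_forall fun a ha => (h.mem_iff.1 ha).2.2.1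
    · exact eventually_nhdsWithin_of_forall fun a ha => (h.mem_iff.1 ha).2.2.2.1
    by_cases htop : b (Fin.last m) = ⊤
    · exact ⟨Or.inl htop, Or.inl htop, fun _ => htop⟩
    · obtain ⟨a, ha, haA⟩ :=
        ((eventually_coord_eq h.subset_stratum hb htop).and self_mem_nhdsWithin).exists
      rw [← ha]
      exact ⟨(h.subset_stratum haA).1 _, (h.mem_iff.1 haA).2.2.2.2,
        fun hI => eq_top_of_mem_closure h.subset_stratum (subset_closure haA) hI⟩
  · rintro ⟨hs, hμb, hνb, hG, hcong, hI⟩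
    have hne := mem_closure_iff_nhdsWithin_neBot.1 hs
    have htend : ∀ {f : (Fin m → Omega Z) → Omega Z},
        ContinuousOn f (closure (socle '' A)) →
        Tendsto f (𝓝[socle '' A] (socle b)) (𝓝 (f (socle b))) := fun hf =>
      (hf _ hs).tendsto.mono_left (nhdsWithin_mono _ subset_closure)
    have hid : Tendsto id (𝓝[socle '' A] (socle b)) (𝓝 (socle b)) :=
      tendsto_id.mono_left nhdsWithin_le_nhds
    -- If `g x` is eventually a legitimate last coordinate over `x`, its limit gives a limit point.
    have glue : ∀ (g : (Fin m → Omega Z) → Omega Z) (c : Omega Z),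
        Tendsto g (𝓝[socle '' A] (socle b)) (𝓝 c) →
        (∀ᶠ x in 𝓝[socle '' A] (socle b), addLast x (g x) ∈ A) →
        addLast (socle b) c ∈ closure A := by
      intro g c hg hgA
      exact mem_closure_of_tendsto
        ((continuous_addLast.tendsto (socle b, c)).comp (hid.prodMk_nhds hg)) hgA
    have fib : ∀ x, ∃ c, x ∈ socle '' A → addLast x c ∈ A := by
      intro x
      by_cases hx : x ∈ socle '' A
      · obtain ⟨a, ha, rfl⟩ := hx
        exact ⟨a (Fin.last m), fun _ => by simpa using ha⟩
      · exact ⟨⊤, fun h' => absurd h' hx⟩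
    choose c hc using fib
    rw [← addLast_socle b]
    by_cases hlast : Fin.last m ∈ I
    swap
    · refine glue c _ (tendsto_const_nhds.congr' ?_)
        (eventually_nhdsWithin_of_forall fun x hx => hc x hx)
      filter_upwards [self_mem_nhdsWithin] with x hx
      have := eq_top_of_mem_closure h.subset_stratum (subset_closure (hc x hx)) hlast
      rw [hI hlast]
      simpa using this.symm
    -- A finite last coordinate satisfying the limit conditions is legitimate near `socle b`.
    have fin : ∀ z : Z, μ (socle b) ≤ ofZ z → ofZ z ≤ ν (socle b) →
        CongrMod (k : ℕ) (ofZ z) (ofZ (ρ • (ZGroup.one : Z))) →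
        addLast (socle b) (ofZ z) ∈ closure A := by
      intro z hz1 hz2 hz3
      have e1 : ∀ᶠ x in 𝓝[socle '' A] (socle b), μ x ≤ ofZ z := by
        obtain ⟨q, hq⟩ :=
          WithTop.ne_top_iff_exists.1 (hz1.trans_lt (WithTop.coe_lt_top _)).ne
        have := (h.1.latticeValuedOn hstrat).eventually_eq self_mem_nhdsWithin
          (q := q) (hq ▸ htend hμ)
        filter_upwards [this] with x hx
        rwa [hx, hq]
      have e2 : ∀ᶠ x in 𝓝[socle '' A] (socle b), ofZ z ≤ ν x := by
        by_cases htop : ν (socle b) = ⊤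
        · have := htend hν
          rw [htop] at this
          exact (this.eventually (lt_mem_nhds (WithTop.coe_lt_top _))).mono fun x hx => le_of_lt hx
        · obtain ⟨q, hq⟩ := WithTop.ne_top_iff_exists.1 htop
          have := (h.2.1.latticeValuedOn hstrat).eventually_eq self_mem_nhdsWithin
            (q := q) (hq ▸ htend hν)
          filter_upwards [this] with x hx
          rwa [hx, hq]
      refine glue (fun _ => ofZ z) _ tendsto_const_nhds ?_
      filter_upwards [e1, e2, self_mem_nhdsWithin] with x h1 h2 hx
      rw [h.mem_iff, addLast_mem_stratum_iff]
      simp only [socle_addLast, addLast_last]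
      exact ⟨⟨hstrat hx, Or.inr ⟨z, rfl⟩, by simp [hlast, ofZ_ne_top]⟩, hx, h1, h2, hz3⟩
    rcases hG with htop | ⟨z, hz⟩
    swap
    · rw [← hz] at hμb hνb hcong ⊢
      exact fin z hμb hνb hcong
    rw [htop] at hνb ⊢
    by_cases hμt : μ (socle b) = ⊤
    · refine glue c _ ?_ (eventually_nhdsWithin_of_forall fun x hx => hc x hx)
      refine tendsto_order.2 ⟨fun p hp => ?_, fun p hp => absurd hp (not_lt.2 le_top)⟩
      have := htend hμ
      rw [hμt] at this
      filter_upwards [this.eventually (lt_mem_nhds hp), self_mem_nhdsWithin] with x hx hxA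
      have := (h.mem_iff.1 (hc x hxA)).2.2.1
      simp only [socle_addLast, addLast_last] at this
      exact lt_of_lt_of_le hx this
    · -- Here `[μ, ν]` is a half-line over `socle b`, and its points in the residue class are cofinal.
      obtain ⟨q, hq⟩ := WithTop.ne_top_iff_exists.1 hμt
      have hcof : (⊤ : Omega Z) ∈ closure {c | addLast (socle b) c ∈ closure A} := by
        rw [_root_.mem_closure_iff_nhds]
        intro U hU
        obtain ⟨l, hl, hlU⟩ := exists_Ioc_subset_of_mem_nhds hU ⟨_, WithTop.coe_lt_top q⟩
        obtain ⟨p, rfl⟩ := WithTop.ne_top_iff_exists.1 hl.ne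
        obtain ⟨z₁, hz₁⟩ := exists_le_ofZ q
        obtain ⟨z₂, hz₂⟩ := exists_le_ofZ p
        obtain ⟨w, hw, hwρ⟩ := exists_ge_congr (k : ℕ) k.pos (ρ • (ZGroup.one : Z))
          (max z₁ (z₂ + ZGroup.one))
        have hw1 : ofZ z₁ ≤ ofZ w := ofZ_le_ofZ.2 ((le_max_left _ _).trans hw)
        have hw2 : ofZ z₂ < ofZ w := by
          rw [← not_le, ofZ_le_ofZ, not_le]
          exact (lt_add_of_pos_right z₂ zgroup_one_pos).trans_le ((le_max_right _ _).trans hw)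
        refine ⟨ofZ w, hlU ⟨hz₂.trans_lt hw2, le_top⟩, ?_⟩
        exact fin w (hq ▸ hz₁.trans hw1) (le_top.trans hνb) (congrMod_ofZ_iff.2 hwρ)
      have hcl : IsClosed {c | addLast (socle b) c ∈ closure A} :=
        isClosed_closure.preimage (continuous_addLast.comp (Continuous.prodMk_right (socle b)))
      exact hcl.closure_subset hcof

/-- Every point of the closure of the socle lifts to the closure of `A`. -/
theorem exists_mem_closure (h : IsPresentation I k A μ ν ρ)
    (hμ : ContinuousOn μ (closure (socle '' A))) (hν : ContinuousOn ν (closure (socle '' A)))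
    {x : Fin m → Omega Z} (hx : x ∈ closure (socle '' A)) :
    ∃ b ∈ closure A, socle b = x := by
  have hstrat := socle_image_subset_stratum h.subset_stratum
  have hne := mem_closure_iff_nhdsWithin_neBot.1 hx
  have htend : ∀ {f : (Fin m → Omega Z) → Omega Z},
      ContinuousOn f (closure (socle '' A)) →
      Tendsto f (𝓝[socle '' A] x) (𝓝 (f x)) := fun hf =>
    (hf _ hx).tendsto.mono_left (nhdsWithin_mono _ subset_closure)
  by_cases hνt : ν x = ⊤
  · refine ⟨addLast x ⊤, (h.mem_closure_iff hμ hν).2 ?_, by simp⟩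
    simp [hx, hνt, Gam, CongrMod]
  · have hμν : μ x ≤ ν x := by
      refine le_of_tendsto_of_tendsto (htend hμ) (htend hν)
        (eventually_nhdsWithin_of_forall ?_)
      rintro _ ⟨a, ha, rfl⟩
      exact (h.mem_iff.1 ha).2.2.1.trans (h.mem_iff.1 ha).2.2.2.1
    obtain ⟨p, hp⟩ := WithTop.ne_top_iff_exists.1 hνt
    obtain ⟨q, hq⟩ := WithTop.ne_top_iff_exists.1 (hμν.trans_lt (lt_top_iff_ne_top.2 hνt)).ne
    -- Both bounds are constant near `x`, so a nearby fibre is also the fibre over `x`.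
    have e1 := (h.1.latticeValuedOn hstrat).eventually_eq self_mem_nhdsWithin
      (q := q) (hq ▸ htend hμ)
    have e2 := (h.2.1.latticeValuedOn hstrat).eventually_eq self_mem_nhdsWithin
      (q := p) (hp ▸ htend hν)
    obtain ⟨_, h1, h2, a, ha, rfl⟩ := (e1.and (e2.and self_mem_nhdsWithin)).exists
    have ha' := h.mem_iff.1 ha
    refine ⟨addLast x (a (Fin.last m)), (h.mem_closure_iff hμ hν).2 ?_, by simp⟩
    simp only [socle_addLast, addLast_last]
    exact ⟨hx, hq ▸ h1 ▸ ha'.2.2.1, hp ▸ h2 ▸ ha'.2.2.2.1, ha'.1.1 _, ha'.2.2.2.2,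
      fun hI => eq_top_of_mem_closure h.subset_stratum (subset_closure ha) hI⟩

/-- The socle of a monohedral largely continuous precell is monohedral. -/
theorem monohedral_socle (h : IsPresentation I k A μ ν ρ)
    (hμ : ContinuousOn μ (closure (socle '' A))) (hν : ContinuousOn ν (closure (socle '' A)))
    (hA : Monohedral A) : Monohedral (socle '' A) := by
  -- If neither face of the socle specialises to the other, lift a witness of each non-inclusion:
  -- the faces of `A` through the two lifts are comparable, and projecting contradicts one witness.
  rintro _ _ ⟨J, rfl, -⟩ ⟨K, rfl, -⟩
  by_contra! hcon
  obtain ⟨⟨x, hx, hxK⟩, ⟨y, hy, hyJ⟩⟩ := And.intro (not_subset.1 hcon.1) (not_subset.1 hcon.2)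
  obtain ⟨b, hb, rfl⟩ := h.exists_mem_closure hμ hν hx.1
  obtain ⟨c, hc, rfl⟩ := h.exists_mem_closure hμ hν hy.1
  have hproj : ∀ L : Finset (Fin (m + 1)), ∀ d, d ∈ closure (face L A) →
      socle d ∈ closure (face (baseSupp L) (socle '' A)) := by
    intro L d hd
    refine closure_mono ?_ (socle_mem_closure hd)
    rintro _ ⟨e, he, rfl⟩
    exact ⟨socle_mem_closure he.1, by rw [supp_socle, he.2]⟩
  have hJ : baseSupp (supp b) = J := by rw [← supp_socle, hx.2]
  have hK : baseSupp (supp c) = K := by rw [← supp_socle, hy.2]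
  rcases hA _ _ ⟨supp b, rfl, b, hb, rfl⟩ ⟨supp c, rfl, c, hc, rfl⟩ with hbc | hbc
  · exact hxK (hK ▸ hproj _ _ (hbc ⟨hb, rfl⟩))
  · exact hyJ (hJ ▸ hproj _ _ (hbc ⟨hc, rfl⟩))

end IsPresentation

end

section

/-! ### Assembling precells -/

variable {Z : Type*} [AddCommGroup Z] [LinearOrder Z] [IsOrderedAddMonoid Z] [ZGroup Z] {m : ℕ}

theorem IsLCPrecell.isPrecell {N : Fin m → ℕ+} {A : Set (Fin m → Omega Z)} (h : IsLCPrecell N A) :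
    IsPrecell N A := by
  cases m with
  | zero => exact h
  | succ m => exact h.1

namespace IsPresentation

variable {I : Finset (Fin (m + 1))} {k : ℕ+} {A : Set (Fin (m + 1) → Omega Z)}
  {μ ν : (Fin m → Omega Z) → Omega Z} {ρ : ℤ}

theorem isLCPrecell_snoc (h : IsPresentation I k A μ ν ρ) {N : Fin m → ℕ+}
    (hN : IsLCPrecell N (socle '' A))
    (hμ : LargelyContinuousOn μ (socle '' A)) (hν : LargelyContinuousOn ν (socle '' A)) :
    IsLCPrecell (Fin.snoc (α := fun _ => ℕ+) N k) A := by
  simp only [IsLCPrecell, IsPrecell, Fin.snoc_castSucc, Fin.snoc_last]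
  exact ⟨⟨hN.isPrecell, I, h.subset_stratum, μ, ν, ρ, h⟩, hN, I, h.subset_stratum, μ, ν, ρ, h,
    hμ, hν⟩

/-! ### Splitting along the socle -/

/-- Unless the fibres are half-lines, `A` is relatively closed over its socle. -/
theorem mem_of_socle_mem (h : IsPresentation I k A μ ν ρ)
    (hμ : ContinuousOn μ (closure (socle '' A))) (hν : ContinuousOn ν (closure (socle '' A)))
    (hI : ¬ (Fin.last m ∈ I ∧ ∀ x ∈ socle '' A, ν x = ⊤)) {b : Fin (m + 1) → Omega Z}
    (hb : b ∈ closure A) (hs : socle b ∈ socle '' A) : b ∈ A := by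
  refine mem_of_mem_closure_of_supp_eq h.subset_stratum hb (supp_eq.2 fun i => ?_)
  induction i using Fin.lastCases with
  | cast i =>
    rw [← mem_baseSupp]
    exact supp_eq.1 (socle_image_subset_stratum h.subset_stratum hs).2 i
  | last =>
    have hb' := (h.mem_closure_iff hμ hν).1 hb
    refine ⟨fun hlast => ?_, fun hne => by_contra fun hlast => hne (hb'.2.2.2.2.2 hlast)⟩
    rcases h.2.1 with htop | ⟨α₀, α, hα⟩
    · exact absurd ⟨hlast, htop⟩ hI
    · have := hb'.2.2.1
      rw [hα _ hs] at this
      exact (this.trans_lt (WithTop.coe_lt_top _)).ne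

theorem bdry_restrict (h : IsPresentation I k A μ ν ρ)
    (hμ : ContinuousOn μ (closure (socle '' A))) (hν : ContinuousOn ν (closure (socle '' A)))
    (hI : ¬ (Fin.last m ∈ I ∧ ∀ x ∈ socle '' A, ν x = ⊤)) {X : Set (Fin m → Omega Z)}
    (hX : X ⊆ socle '' A) (hbd : bdry X = bdry (socle '' A)) :
    bdry {a | a ∈ A ∧ socle a ∈ X} = bdry A := by
  have hstrat := socle_image_subset_stratum h.subset_stratum
  have h' := h.restrict hX
  rw [bdry_eq hstrat, bdry_eq (hX.trans hstrat)] at hbd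
  rw [bdry_eq h.subset_stratum, bdry_eq h'.subset_stratum]
  have hsub : {a | a ∈ A ∧ socle a ∈ X} ⊆ A := fun a ha => ha.1
  ext b
  constructor
  · rintro ⟨hb, hbA⟩
    refine ⟨closure_mono hsub hb, fun hbA' => hbA ?_⟩
    exact mem_of_mem_closure_of_supp_eq h'.subset_stratum hb (h.subset_stratum hbA').2
  · rintro ⟨hb, hbA⟩
    refine ⟨?_, fun hb' => hbA (hsub hb')⟩
    have hs : socle b ∈ closure (socle '' A) \ socle '' A :=
      ⟨socle_mem_closure hb, fun hs => hbA (h.mem_of_socle_mem hμ hν hI hb hs)⟩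
    rw [← hbd] at hs
    have hcl : closure (socle '' {a | a ∈ A ∧ socle a ∈ X}) ⊆ closure (socle '' A) :=
      closure_mono (image_mono hsub)
    rw [h'.mem_closure_iff (hμ.mono hcl) (hν.mono hcl), socle_image_restrict hX]
    exact ⟨hs.1, ((h.mem_closure_iff hμ hν).1 hb).2⟩

end IsPresentation

/-! ### Splitting the last coordinate by residues -/

/-- The points of `A` whose last coordinate is congruent to `ρ + k j` modulo `n k`. -/
def residuePart (n k : ℕ+) (A : Set (Fin (m + 1) → Omega Z)) (ρ : ℤ) (j : Fin n) :
    Set (Fin (m + 1) → Omega Z) :=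
  {a | a ∈ A ∧ CongrMod ((n * k : ℕ+) : ℕ) (a (Fin.last m))
    (ofZ ((ρ + (k : ℤ) * (j : ℕ)) • (ZGroup.one : Z)))}

theorem sub_residue_eq {n k : ℕ} (hk : k ≠ 0) {z w : Z} {ρ : ℤ}
    (h : z - ρ • (ZGroup.one : Z) = k • w) (j : ℕ) (y : Z) :
    z - (ρ + (k : ℤ) * (j : ℤ)) • (ZGroup.one : Z) = (n * k) • y ↔
      w - j • (ZGroup.one : Z) = n • y := by
  have e : z - (ρ + (k : ℤ) * (j : ℤ)) • (ZGroup.one : Z) = k • (w - j • (ZGroup.one : Z)) := by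
    rw [add_smul, ← sub_sub, h, mul_smul, natCast_zsmul, natCast_zsmul, smul_sub]
  rw [e, mul_comm, mul_smul, nsmul_right_inj hk]

theorem sub_eq_of_sub_residue_eq {n k j : ℕ} {x z : Z} {ρ : ℤ}
    (h : x - (ρ + (k : ℤ) * (j : ℤ)) • (ZGroup.one : Z) = (n * k) • z) :
    x - ρ • (ZGroup.one : Z) = k • (n • z + j • ZGroup.one) := by
  rw [add_smul, ← sub_sub, sub_eq_iff_eq_add, mul_smul, mul_smul, natCast_zsmul,
    natCast_zsmul, smul_comm] at h
  rw [h, smul_add]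

namespace IsPresentation

variable {I : Finset (Fin (m + 1))} {k : ℕ+} {A : Set (Fin (m + 1) → Omega Z)}
  {μ ν : (Fin m → Omega Z) → Omega Z} {ρ : ℤ}

theorem existsUnique_residuePart (h : IsPresentation I k A μ ν ρ) (hlast : Fin.last m ∈ I)
    (n : ℕ+) {a : Fin (m + 1) → Omega Z} (ha : a ∈ A) : ∃! j, a ∈ residuePart n k A ρ j := by
  obtain ⟨z, hz⟩ : ∃ z, ofZ z = a (Fin.last m) :=
    ((h.subset_stratum ha).1 _).resolve_left ((supp_eq.1 (h.subset_stratum ha).2 _).1 hlast)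
  have hc := (h.mem_iff.1 ha).2.2.2.2
  rw [← hz, congrMod_ofZ_iff] at hc
  obtain ⟨w, hw⟩ := hc
  have key : ∀ j, a ∈ residuePart n k A ρ j ↔ ∃ y : Z, w - (j : ℕ) • ZGroup.one = (n : ℕ) • y := by
    intro j
    rw [residuePart, mem_ofPred_eq, and_iff_right ha, ← hz, congrMod_ofZ_iff]
    exact exists_congr fun y => by
      rw [PNat.mul_coe, sub_residue_eq k.ne_zero hw]
  simp only [key]
  exact existsUnique_residue n n.pos w

theorem socle_image_residuePart (h : IsPresentation I k A μ ν ρ) (hlast : Fin.last m ∈ I)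
    (hνt : ∀ x ∈ socle '' A, ν x = ⊤) (n : ℕ+) (j : Fin n) :
    socle '' residuePart n k A ρ j = socle '' A := by
  refine (image_mono fun a ha => ha.1).antisymm ?_
  rintro _ ⟨a, ha, rfl⟩
  have ha' := h.mem_iff.1 ha
  obtain ⟨z, hz⟩ : ∃ z, ofZ z = a (Fin.last m) :=
    (ha'.1.1 _).resolve_left ((supp_eq.1 ha'.1.2 _).1 hlast)
  obtain ⟨w, hzw, y, hy⟩ := exists_ge_congr ((n * k : ℕ+) : ℕ) (n * k).pos
    ((ρ + (k : ℤ) * (j : ℕ)) • (ZGroup.one : Z)) z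
  refine ⟨addLast (socle a) (ofZ w), ⟨?_, ?_⟩, socle_addLast _ _⟩
  · rw [h.mem_iff, addLast_mem_stratum_iff]
    simp only [socle_addLast, addLast_last]
    refine ⟨⟨socle_image_subset_stratum h.subset_stratum ha'.2.1, Or.inr ⟨w, rfl⟩,
      by simp [hlast, ofZ_ne_top]⟩, ha'.2.1, ha'.2.2.1.trans (hz ▸ ofZ_le_ofZ.2 hzw),
      (hνt _ ha'.2.1).symm ▸ le_top, congrMod_ofZ_iff.2 ⟨(n : ℕ) • y + (j : ℕ) • ZGroup.one, ?_⟩⟩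
    exact sub_eq_of_sub_residue_eq hy
  · rw [addLast_last]
    exact congrMod_ofZ_iff.2 ⟨y, hy⟩

theorem isPresentation_residuePart (h : IsPresentation I k A μ ν ρ) (hlast : Fin.last m ∈ I)
    (hνt : ∀ x ∈ socle '' A, ν x = ⊤) (n : ℕ+) (j : Fin n) :
    IsPresentation I (n * k) (residuePart n k A ρ j) μ ν (ρ + (k : ℤ) * (j : ℕ)) := by
  have hsoc := h.socle_image_residuePart hlast hνt n j
  unfold IsPresentation
  rw [hsoc]
  obtain ⟨h1, h2, h3, h4, h5, h6, -⟩ := id h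
  refine ⟨h1, h2, h3, h4, by positivity, ?_, ?_⟩
  · have hj : ((j : ℕ) : ℤ) + 1 ≤ (n : ℤ) := by exact_mod_cast j.2
    have hk : (0 : ℤ) < (k : ℤ) := by exact_mod_cast k.pos
    push_cast
    nlinarith
  · ext a
    constructor
    · rintro ⟨ha, hc⟩
      have ha' := h.mem_iff.1 ha
      exact ⟨ha'.1, ha'.2.1, ha'.2.2.1, ha'.2.2.2.1, hc⟩
    · rintro ⟨a1, a2, a3, a4, hc⟩
      refine ⟨h.mem_iff.2 ⟨a1, a2, a3, a4, ?_⟩, hc⟩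
      rcases hc with hc | hc | ⟨x, y, z, hx, hy, hxy⟩
      · exact Or.inl hc
      · exact absurd hc (ofZ_ne_top _)
      · rw [hx]
        refine congrMod_ofZ_iff.2 ⟨(n : ℕ) • z + (j : ℕ) • ZGroup.one, ?_⟩
        rw [← ofZ_injective hy] at hxy
        exact sub_eq_of_sub_residue_eq hxy

/-- If the fibres of a monohedral `A` are half-lines, then all its boundary points are at infinity
in the last coordinate: a boundary point with finite last coordinate would lie on a face whose
support is incomparable with that of the face `socle '' A × {+∞}`. -/
theorem last_eq_top_of_mem_closure_diff (h : IsPresentation I k A μ ν ρ)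
    (hμ : ContinuousOn μ (closure (socle '' A))) (hν : ContinuousOn ν (closure (socle '' A)))
    (hνt : ∀ x ∈ socle '' A, ν x = ⊤) (hA : Monohedral A)
    {b : Fin (m + 1) → Omega Z} (hb : b ∈ closure A) (hbA : b ∉ A) : b (Fin.last m) = ⊤ := by
  by_contra hne
  obtain ⟨i, hiI, hi⟩ : ∃ i ∈ I, b i = ⊤ := by
    by_contra! hcon
    refine hbA (mem_of_mem_closure_of_supp_eq h.subset_stratum hb
      (supp_eq.2 fun i => ⟨hcon i, fun hi => ?_⟩))
    exact by_contra fun hiI => hi (eq_top_of_mem_closure h.subset_stratum hb hiI)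
  obtain ⟨a, ha⟩ : A.Nonempty := closure_nonempty_iff.1 ⟨b, hb⟩
  have hsa : socle a ∈ socle '' A := mem_image_of_mem _ ha
  set c : Fin (m + 1) → Omega Z := addLast (socle a) ⊤ with hc
  have hcA : c ∈ closure A := by
    rw [h.mem_closure_iff hμ hν]
    simp [hc, subset_closure hsa, hνt _ hsa, Gam, CongrMod]
  have top_of_mem : ∀ (J : Finset (Fin (m + 1))) (x : Fin (m + 1) → Omega Z) (l : Fin (m + 1)),
      x ∈ closure (face J A) → l ∉ J → x l = ⊤ := by
    intro J x l hx hl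
    refine eq_top_of_mem_closure_of_forall (fun y hy => ?_) hx
    exact by_contra fun hyl => hl ((supp_eq.1 hy.2 l).2 hyl)
  rcases hA _ _ ⟨supp b, rfl, b, hb, rfl⟩ ⟨supp c, rfl, c, hcA, rfl⟩ with hbc | hbc
  · exact hne (top_of_mem _ _ _ (hbc ⟨hb, rfl⟩) (by simp [mem_supp, hc]))
  · have hci : c i = ⊤ := top_of_mem _ _ _ (hbc ⟨hcA, rfl⟩) (by simp [mem_supp, hi])
    have hai : c i = a i := by
      induction i using Fin.lastCases with
      | last => exact absurd hi hne
      | cast i => exact congrFun (socle_addLast (socle a) ⊤) i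
    exact (supp_eq.1 (h.subset_stratum ha).2 i).1 hiI (hai ▸ hci)

theorem bdry_residuePart (h : IsPresentation I k A μ ν ρ)
    (hμ : ContinuousOn μ (closure (socle '' A))) (hν : ContinuousOn ν (closure (socle '' A)))
    (hlast : Fin.last m ∈ I) (hνt : ∀ x ∈ socle '' A, ν x = ⊤) (hA : Monohedral A)
    (n : ℕ+) (j : Fin n) : bdry (residuePart n k A ρ j) = bdry A := by
  have h' := h.isPresentation_residuePart hlast hνt n j
  have hsoc := h.socle_image_residuePart hlast hνt n j
  have hsub : residuePart n k A ρ j ⊆ A := fun a ha => ha.1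
  rw [bdry_eq h.subset_stratum, bdry_eq h'.subset_stratum]
  ext b
  constructor
  · rintro ⟨hb, hbA⟩
    refine ⟨closure_mono hsub hb, fun hbA' => hbA ?_⟩
    exact mem_of_mem_closure_of_supp_eq h'.subset_stratum hb (h.subset_stratum hbA').2
  · rintro ⟨hb, hbA⟩
    refine ⟨?_, fun hb' => hbA (hsub hb')⟩
    have htop := h.last_eq_top_of_mem_closure_diff hμ hν hνt hA hb hbA
    obtain ⟨b1, b2, b3, b4, -⟩ := (h.mem_closure_iff hμ hν).1 hb
    rw [h'.mem_closure_iff (hsoc.symm ▸ hμ) (hsoc.symm ▸ hν), hsoc]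
    exact ⟨b1, b2, b3, b4, Or.inl htop, fun _ => htop⟩

end IsPresentation

/-! ### The partition -/

theorem exists_partition (n : ℕ+) {m : ℕ} (N : Fin m → ℕ+) (A : Set (Fin m → Omega Z))
    (hA : IsLCPrecell N A) (hmono : Monohedral A) (hclosed : ¬ IsClosed A) :
    ∃ (N' : Fin m → ℕ+) (P : Fin n → Set (Fin m → Omega Z)),
      (∀ i, (P i).Nonempty) ∧ (∀ i j, i ≠ j → Disjoint (P i) (P j)) ∧ (⋃ i, P i) = A ∧
      (∀ i, IsLCPrecell N' (P i)) ∧ (∀ i, bdry (P i) = bdry A) := by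
  induction m with
  | zero => exact absurd (hA ▸ isClosed_univ) hclosed
  | succ m ih =>
    obtain ⟨-, hsocle, I, -, μ₀, ν₀, ρ, h₀, ⟨μ, hμ, hμ₀⟩, ⟨ν, hν, hν₀⟩⟩ := hA
    have h := h₀.congr hμ₀ hν₀
    have hne : (socle '' A).Nonempty :=
      (nonempty_iff_ne_empty.2 fun h0 => hclosed (by rw [h0]; exact isClosed_empty)).image _
    by_cases hI : Fin.last m ∈ I ∧ ∀ x ∈ socle '' A, ν x = ⊤
    · obtain ⟨hlast, hνt⟩ := hI
      have hs := h.socle_image_residuePart hlast hνt n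
      refine ⟨Fin.snoc (α := fun _ => ℕ+) (fun i => N i.castSucc) (n * N (Fin.last m)),
        residuePart n (N (Fin.last m)) A ρ, fun j => ?_, fun i j hij => ?_,
        ?_, fun j => ?_, h.bdry_residuePart hμ hν hlast hνt hmono n⟩
      · rw [← image_nonempty, hs j]
        exact hne
      · refine disjoint_left.2 fun a hai haj => hij ?_
        exact (h.existsUnique_residuePart hlast n hai.1).unique hai haj
      · refine (iUnion_subset fun j a ha => ha.1).antisymm fun a ha => ?_
        exact mem_iUnion.2 (h.existsUnique_residuePart hlast n ha).exists
      · refine (h.isPresentation_residuePart hlast hνt n j).isLCPrecell_snoc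
          (N := fun i => N i.castSucc) ?_ ⟨μ, ?_, fun _ _ => rfl⟩ ⟨ν, ?_, fun _ _ => rfl⟩ <;> rwa [hs j]
    · have hsclosed : ¬ IsClosed (socle '' A) := fun hc => hclosed <| by
        rw [← closure_subset_iff_isClosed]
        intro b hb
        exact h.mem_of_socle_mem hμ hν hI hb (hc.closure_eq ▸ socle_mem_closure hb)
      obtain ⟨N', X, hXne, hXd, hXu, hXlc, hXb⟩ :=
        ih _ _ hsocle (h.monohedral_socle hμ hν hmono) hsclosed
      have hX : ∀ i, X i ⊆ socle '' A := fun i => hXu ▸ subset_iUnion X i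
      have hs : ∀ i, socle '' {a | a ∈ A ∧ socle a ∈ X i} = X i := fun i =>
        socle_image_restrict (hX i)
      have hcl : ∀ i, closure (X i) ⊆ closure (socle '' A) := fun i => closure_mono (hX i)
      refine ⟨Fin.snoc (α := fun _ => ℕ+) N' (N (Fin.last m)),
        fun i => {a | a ∈ A ∧ socle a ∈ X i}, fun i => ?_, fun i j hij => ?_,
        ?_, fun i => ?_, fun i => h.bdry_restrict hμ hν hI (hX i) (hXb i)⟩
      · rw [← image_nonempty (f := socle), hs i]
        exact hXne i
      · exact disjoint_left.2 fun a hai haj => disjoint_left.1 (hXd i j hij) hai.2 haj.2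
      · refine (iUnion_subset fun i a ha => ha.1).antisymm fun a ha => ?_
        have : socle a ∈ ⋃ i, X i := hXu ▸ mem_image_of_mem _ ha
        obtain ⟨i, hi⟩ := mem_iUnion.1 this
        exact mem_iUnion.2 ⟨i, ha, hi⟩
      · refine (h.restrict (hX i)).isLCPrecell_snoc (N := N') ?_ ⟨μ, ?_, fun _ _ => rfl⟩
          ⟨ν, ?_, fun _ _ => rfl⟩ <;> rw [hs i]
        · exact hXlc i
        · exact hμ.mono (hcl i)
        · exact hν.mono (hcl i)

end

end Precell

theorem proposition5p6 {Z : Type*} [AddCommGroup Z] [LinearOrder Z] [IsOrderedAddMonoid Z]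
    [ZGroup Z] {m : ℕ} (I : Finset (Fin m)) (N : Fin m → ℕ+) (A : Set (Fin m → Omega Z))
    (hAI : A ⊆ stratum Z I) (hA : IsLCPrecell N A) (hmono : Monohedral A)
    (hclosed : ¬ IsClosed A) (n : ℕ) (hn : 1 ≤ n) :
    ∃ (N' : Fin m → ℕ+) (P : Fin n → Set (Fin m → Omega Z)),
      (∀ i, (P i).Nonempty) ∧ (∀ i j, i ≠ j → Disjoint (P i) (P j)) ∧ (⋃ i, P i) = A ∧
      (∀ i, IsLCPrecell N' (P i)) ∧ (∀ i, bdry (P i) = bdry A) :=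
  exists_partition ⟨n, hn⟩ N A hA hmono hclosed
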